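/- Let $E=\mathbb{R}\times\{-1,+1\}$ with the product topology, let $C_0(E)$ be the space of continuous functions $E\to\mathbb{R}$ vanishing at infinity, let $a>0$, and let $\lambda:E\to[0,\infty)$ be continuous. Assume that there are constants $y_0\ge 0$ and $\lambda_{\min}>0$ such that $\lambda(y,j)\ge\lambda_{\min}$ whenever $jy\ge y_0$ (no upper bound on $\lambda$ is assumed). For $(y,j)\in E$ and $t\ge 0$ put $F(t;y,j)=\exp\bigl(-\int_0^t\lambda(y+ajs,j)\,ds\bigr)$. The zig-zag process $(Y(t),J(t))_{t\ge 0}$ started from $(y,j)$ is constructed under $\mathbb{P}_{y,j}$ as follows: $T_0=0$, $(Y(0),J(0))=(y,j)$ and, for $i=1,2,\dots$, $T_i=T_{i-1}+Z_i$, where $\mathbb{P}_{y,j}(Z_i>t\mid Z_1,\dots,Z_{i-1})=F(t;Y(T_{i-1}),J(T_{i-1}))$ for $t\ge0$; moreover $Y(t)=Y(T_{i-1})+aJ(T_{i-1})(t-T_{i-1})$ for $T_{i-1}<t\le T_i$, $J(t)=J(T_{i-1})$ for $T_{i-1}<t<T_i$, and $J(T_i)=-J(T_{i-1})$. Let $P(t)\varphi(y,j)=\mathbb{E}_{y,j}[\varphi(Y(t),J(t))]$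 be the associated transition semigroup. Then $T_n\to\infty$ almost surely under every $\mathbb{P}_{y,j}$, so that the process is defined for all times and $P(t)$ is well defined, and the semigroup is Feller: for every $\varphi\in C_0(E)$ and every $t\ge 0$, $P(t)\varphi\in C_0(E)$. -/

import Mathlib

open MeasureTheory ProbabilityTheory Filter Topology Set
open scoped ZeroAtInfty

/-- The state space `E = ℝ × {-1, +1}` with the product topology; the group `ℤˣ = {1, -1}` plays
the role of the two-point set of directions. -/
abbrev ZigZagSpace : Type := ℝ × ℤˣ

instance zigZagDirection_discreteMeasurable : DiscreteMeasurableSpace ℤˣ where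
  forall_measurableSet s :=
    ⟨Units.val '' s, MeasurableSet.of_discrete, Set.preimage_image_eq s Units.val_injective⟩

/-- The data of a zig-zag process: the speed `a > 0`, the continuous switching rate
`λ : E → [0, ∞)`, and the lower bound on the rate of good switches in the tails. -/
structure ZigZagModel where
  /-- the speed -/
  a : ℝ
  a_pos : 0 < a
  /-- the switching rate -/
  rate : ZigZagSpace → ℝ
  rate_continuous : Continuous rate
  rate_nonneg : ∀ x, 0 ≤ rate x
  rate_tail : ∃ y₀ : ℝ, 0 ≤ y₀ ∧ ∃ lmin : ℝ, 0 < lmin ∧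
    ∀ (y : ℝ) (j : ℤˣ), y₀ ≤ ((j : ℤ) : ℝ) * y → lmin ≤ rate (y, j)

namespace ZigZagModel

variable (M : ZigZagModel)

/-- The position `y + a j s` reached from `(y, j)` after moving for time `s` without switching,
together with the unchanged direction `j`. -/
def flow (x : ZigZagSpace) (s : ℝ) : ZigZagSpace :=
  (x.1 + M.a * ((x.2 : ℤ) : ℝ) * s, x.2)

/-- The survival function `F(t; y, j) = exp (- ∫₀ᵗ λ(y + a j s, j) ds)`. -/
noncomputable def survival (x : ZigZagSpace) (t : ℝ) : ℝ :=
  Real.exp (-∫ s in (0 : ℝ)..t, M.rate (M.flow x s))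

/-- The law on `(0, ∞)` with distribution function `1 - F(·; y, j)`, given by its density
`-F'(t; y, j) = λ(y + a j t, j) F(t; y, j)`; see `holdingLaw_Ioi`. -/
noncomputable def holdingLaw (x : ZigZagSpace) : Measure ℝ :=
  (volume.restrict (Ioi 0)).withDensity
    fun t => ENNReal.ofReal (M.rate (M.flow x t) * M.survival x t)

theorem continuous_flow : Continuous fun p : ZigZagSpace × ℝ => M.flow p.1 p.2 := by
  have h : Continuous fun j : ℤˣ => ((j : ℤ) : ℝ) := continuous_of_discreteTopology
  have h' : Continuous fun p : ZigZagSpace × ℝ => ((p.1.2 : ℤ) : ℝ) :=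
    h.comp (continuous_snd.comp continuous_fst)
  unfold flow
  fun_prop

theorem continuous_rate_flow :
    Continuous fun p : ZigZagSpace × ℝ => M.rate (M.flow p.1 p.2) :=
  M.rate_continuous.comp M.continuous_flow

theorem continuous_survival : Continuous fun p : ZigZagSpace × ℝ => M.survival p.1 p.2 := by
  unfold survival
  refine Real.continuous_exp.comp (Continuous.neg ?_)
  exact intervalIntegral.continuous_parametric_primitive_of_continuous
    (f := fun x s => M.rate (M.flow x s)) M.continuous_rate_flow

theorem continuous_rate_flow_right (x : ZigZagSpace) :
    Continuous fun s => M.rate (M.flow x s) :=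
  M.continuous_rate_flow.comp (by fun_prop : Continuous fun s : ℝ => (x, s))

theorem hasDerivAt_neg_survival (x : ZigZagSpace) (t : ℝ) :
    HasDerivAt (fun t => -M.survival x t) (M.rate (M.flow x t) * M.survival x t) t := by
  have hc := M.continuous_rate_flow_right x
  have h := intervalIntegral.integral_hasDerivAt_right (hc.intervalIntegrable 0 t)
    (hc.stronglyMeasurableAtFilter _ _) hc.continuousAt
  refine h.neg.exp.neg.congr_deriv ?_
  change -(Real.exp (-∫ s in (0 : ℝ)..t, M.rate (M.flow x s)) * -M.rate (M.flow x t)) =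
    M.rate (M.flow x t) * Real.exp (-∫ s in (0 : ℝ)..t, M.rate (M.flow x s))
  ring

theorem tendsto_survival (x : ZigZagSpace) :
    Tendsto (M.survival x) atTop (𝓝 0) := by
  obtain ⟨y₀, -, l, hl, h⟩ := M.rate_tail
  have hc := M.continuous_rate_flow_right x
  obtain ⟨y, j⟩ := x
  have ha := M.a_pos
  have hj : ((j : ℤ) : ℝ) * ((j : ℤ) : ℝ) = 1 := by
    rcases Int.units_eq_one_or j with rfl | rfl <;> simp
  set c : ℝ := ((j : ℤ) : ℝ) with hcdef
  set t₀ : ℝ := (|y₀| + |c * y|) / M.a with ht₀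
  have key : ∀ s, t₀ ≤ s → l ≤ M.rate (M.flow (y, j) s) := by
    intro s hs
    apply h
    have h1 : |y₀| + |c * y| ≤ s * M.a := (div_le_iff₀ ha).1 hs
    have h2 := neg_abs_le (c * y)
    have h3 := le_abs_self y₀
    have h4 : c * (y + M.a * c * s) = c * y + s * M.a := by linear_combination (M.a * s) * hj
    rw [← hcdef, h4]
    linarith
  unfold survival
  refine Real.tendsto_exp_neg_atTop_nhds_zero.comp ?_
  have hlin : Tendsto (fun t => (∫ s in (0 : ℝ)..t₀, M.rate (M.flow (y, j) s)) + l * (t - t₀))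
      atTop atTop :=
    tendsto_atTop_add_const_left _ _
      ((tendsto_atTop_add_const_right _ (-t₀) tendsto_id).const_mul_atTop hl)
  refine tendsto_atTop_mono' _ ?_ hlin
  filter_upwards [eventually_ge_atTop t₀] with t ht
  rw [← intervalIntegral.integral_add_adjacent_intervals (hc.intervalIntegrable 0 t₀)
    (hc.intervalIntegrable t₀ t)]
  gcongr
  have := intervalIntegral.integral_mono_on (μ := volume) ht (intervalIntegrable_const (c := l))
    (hc.intervalIntegrable t₀ t) (fun s hs => key s hs.1)
  simpa [mul_comm] using this

/-- A holding time `Z` with law `holdingLaw x` satisfies `ℙ(Z > t) = F(t; x)`. -/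
theorem holdingLaw_Ioi (x : ZigZagSpace) {t : ℝ} (ht : 0 ≤ t) :
    M.holdingLaw x (Ioi t) = ENNReal.ofReal (M.survival x t) := by
  have hlim : Tendsto (fun t => -M.survival x t) atTop (𝓝 (-0)) := (M.tendsto_survival x).neg
  have hnn : ∀ s, 0 ≤ M.rate (M.flow x s) * M.survival x s := fun s =>
    mul_nonneg (M.rate_nonneg _) (Real.exp_pos _).le
  have hint := integrableOn_Ioi_deriv_of_nonneg' (a := t)
    (fun s _ => M.hasDerivAt_neg_survival x s) (fun s _ => hnn s) hlim
  have hval := integral_Ioi_of_hasDerivAt_of_nonneg' (a := t)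
    (fun s _ => M.hasDerivAt_neg_survival x s) (fun s _ => hnn s) hlim
  rw [holdingLaw, withDensity_apply _ measurableSet_Ioi,
    Measure.restrict_restrict measurableSet_Ioi,
    inter_eq_left.2 (Ioi_subset_Ioi ht),
    ← ofReal_integral_eq_lintegral_ofReal hint (ae_of_all _ hnn), hval]
  simp

instance (x : ZigZagSpace) : IsProbabilityMeasure (M.holdingLaw x) := by
  constructor
  have h0 := M.holdingLaw_Ioi x le_rfl
  have h1 : M.holdingLaw x (Iic 0) = 0 := by
    rw [holdingLaw, withDensity_apply _ measurableSet_Iic,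
      Measure.restrict_restrict measurableSet_Iic,
      (Iic_disjoint_Ioi (le_refl (0 : ℝ))).inter_eq, Measure.restrict_empty, lintegral_zero_measure]
  rw [← Iic_union_Ioi (a := (0 : ℝ)),
    measure_union (Iic_disjoint_Ioi le_rfl) measurableSet_Ioi, h0, h1]
  simp [survival]

/-- The holding-time laws, as a Markov kernel from `E` to `ℝ`. -/
noncomputable def holdingKernel : Kernel ZigZagSpace ℝ where
  toFun := M.holdingLaw
  measurable' := by
    have hm : Measurable (Function.uncurry fun (x : ZigZagSpace) (t : ℝ) =>
        ENNReal.ofReal (M.rate (M.flow x t) * M.survival x t)) :=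
      ENNReal.measurable_ofReal.comp
        (M.continuous_rate_flow.mul M.continuous_survival).measurable
    have h : M.holdingLaw = fun x => (Kernel.withDensity
        (Kernel.const ZigZagSpace (volume.restrict (Ioi (0 : ℝ))))
        fun x t => ENNReal.ofReal (M.rate (M.flow x t) * M.survival x t)) x := by
      funext x
      rw [Kernel.withDensity_apply _ hm]
      rfl
    rw [h]
    exact Kernel.measurable _

instance : IsMarkovKernel M.holdingKernel :=
  ⟨fun x => inferInstanceAs (IsProbabilityMeasure (M.holdingLaw x))⟩

/-- The effect of a holding time `z` on a pair (state just after a switch, time of that switch):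
move for time `z`, then reverse the direction; `(Y, J), T ↦ (Y + a J z, -J), T + z`. -/
def jump (p : (ZigZagSpace × ℝ) × ℝ) : ZigZagSpace × ℝ :=
  (((M.flow p.1.1 p.2).1, -p.1.1.2), p.1.2 + p.2)

theorem measurable_jump : Measurable M.jump := by
  have hf : Measurable fun p : (ZigZagSpace × ℝ) × ℝ => M.flow p.1.1 p.2 :=
    M.continuous_flow.measurable.comp
      ((measurable_fst.comp measurable_fst).prodMk measurable_snd)
  have hneg : Measurable fun j : ℤˣ => -j := Measurable.of_discrete
  exact ((measurable_fst.comp hf).prodMk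
    (hneg.comp (measurable_snd.comp (measurable_fst.comp measurable_fst)))).prodMk
    ((measurable_snd.comp measurable_fst).add measurable_snd)

/-- The transition kernel of the chain `((Y(Tₙ), J(Tₙ)), Tₙ)`: draw `Z` from the holding-time law
of `(Y(Tₙ), J(Tₙ))`, then apply `jump`. -/
noncomputable def jumpKernel : Kernel (ZigZagSpace × ℝ) (ZigZagSpace × ℝ) :=
  (Kernel.id ×ₖ M.holdingKernel.comap Prod.fst measurable_fst).map M.jump

instance : IsMarkovKernel M.jumpKernel :=
  Kernel.IsMarkovKernel.map _ M.measurable_jump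

/-- The law `ℙ_{y,j}` of the sequence `((Y(Tₙ), J(Tₙ)), Tₙ)`, `n = 0, 1, 2, …`, started from
`((y, j), 0)`: the Markov chain with transition kernel `jumpKernel`. -/
noncomputable def law (x : ZigZagSpace) : Measure (ℕ → ZigZagSpace × ℝ) :=
  Kernel.trajMeasure (X := fun _ => ZigZagSpace × ℝ) (Measure.dirac (x, 0))
    (fun n => M.jumpKernel.comap
      (fun h : (i : Finset.Iic n) → ZigZagSpace × ℝ => h ⟨n, Finset.mem_Iic.2 le_rfl⟩)
      (measurable_pi_apply _))

/-- The `n`-th switching time `Tₙ`. -/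
def switchTime (ω : ℕ → ZigZagSpace × ℝ) (n : ℕ) : ℝ := (ω n).2

/-- `N(t) = sup {k : T_k ≤ t}`, the number of switches up to time `t`. The supremum of an
unbounded set of naturals is `0` by convention. -/
noncomputable def switchCount (t : ℝ) (ω : ℕ → ZigZagSpace × ℝ) : ℕ :=
  sSup {k : ℕ | switchTime ω k ≤ t}

/-- The zig-zag process `(Y(t), J(t))`: with `n = N(t)`, it moves from `(Y(Tₙ), J(Tₙ))` for time
`t - Tₙ` without switching. -/
noncomputable def process (t : ℝ) (ω : ℕ → ZigZagSpace × ℝ) : ZigZagSpace :=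
  M.flow (ω (switchCount t ω)).1 (t - switchTime ω (switchCount t ω))

/-- The transition semigroup `P(t) φ (y, j) = 𝔼_{y,j} [φ(Y(t), J(t))]`. -/
noncomputable def semigroup (t : ℝ) (φ : ZigZagSpace → ℝ) (x : ZigZagSpace) : ℝ :=
  ∫ ω, φ (M.process t ω) ∂(M.law x)

end ZigZagModel

namespace ZigZagModel

variable (M : ZigZagModel)

/-! Split $\varphi(Y(t),J(t))$ according to the number $n$ of switches before time $t$. By the
Markov property of the skeleton chain, the expectation of the $n$-th piece is $R^n u\,(x,0)$, where
$R$ is `renewal` and $u$ is `noSwitchValue` (`integral_law_stepValue`). The operator $R$ integrates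
a continuous density over a compact time interval, so it preserves continuity although
$\varphi(Y(t),J(t))$ jumps along paths.

The rate $\lambda$ may be unbounded, but the speed is finite: from $|y|\le R_0$ only positions in
$|y|\le R_0+at$ are reached by time $t$, and there $\lambda\le\Lambda$. Hence $|R^n u|\le C(\Lambda
t)^n/n!$ locally uniformly (`abs_iterate_renewal_le`). This one bound yields non-explosion (with
$u=1$ and Borel–Cantelli), the interchange of sum and expectation (`hasSum_semigroup`), and
continuity by the Weierstrass test (`continuous_semigroup`). Decay at infinity follows from
$|Y(t)-y|\le at$. The tail bound on $\lambda$ serves only to make the holding times almost surely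
finite. -/

instance (x : ZigZagSpace) : IsProbabilityMeasure (M.law x) := by
  unfold law
  infer_instance

/-! ### Markov property of the skeleton chain. -/

theorem jumpKernel_apply (p : ZigZagSpace × ℝ) :
    M.jumpKernel p = (M.holdingLaw p.1).map fun z => M.jump (p, z) := by
  have h : Measurable fun z : ℝ => (p, z) := measurable_prodMk_left
  rw [jumpKernel, Kernel.map_apply _ M.measurable_jump, Kernel.prod_apply, Kernel.id_apply,
    Kernel.comap_apply, Measure.dirac_prod, Measure.map_map M.measurable_jump h]
  rfl

/-- The Markov property of the chain of switching states and times, for one step. -/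
theorem map_law_pair (x : ZigZagSpace) (n : ℕ) :
    (M.law x).map (fun ω => (ω n, ω (n + 1))) =
      (M.law x).map (fun ω => ω n) ⊗ₘ M.jumpKernel := by
  set e : ((i : Finset.Iic n) → ZigZagSpace × ℝ) → ZigZagSpace × ℝ :=
    fun h => h ⟨n, Finset.mem_Iic.2 le_rfl⟩ with he
  have hem : Measurable e := measurable_pi_apply _
  have H := Kernel.map_frestrictLe_trajMeasure_compProd_eq_map_trajMeasure
    (X := fun _ => ZigZagSpace × ℝ) (μ₀ := Measure.dirac (x, (0 : ℝ)))
    (κ := fun n => M.jumpKernel.comap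
      (fun h : (i : Finset.Iic n) → ZigZagSpace × ℝ => h ⟨n, Finset.mem_Iic.2 le_rfl⟩)
      (measurable_pi_apply _)) (a := n)
  change (M.law x).map (Preorder.frestrictLe n) ⊗ₘ M.jumpKernel.comap e hem =
    (M.law x).map (fun ω => (Preorder.frestrictLe n ω, ω (n + 1))) at H
  have hfr : Measurable (Preorder.frestrictLe (π := fun _ : ℕ => ZigZagSpace × ℝ) n) :=
    Preorder.measurable_frestrictLe n
  have : IsProbabilityMeasure ((M.law x).map
      (Preorder.frestrictLe (π := fun _ : ℕ => ZigZagSpace × ℝ) n)) :=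
    Measure.isProbabilityMeasure_map hfr.aemeasurable
  have : IsProbabilityMeasure ((M.law x).map (fun ω => ω n)) :=
    Measure.isProbabilityMeasure_map (measurable_pi_apply n).aemeasurable
  have hn : (fun ω : ℕ → ZigZagSpace × ℝ => ω n) = e ∘ Preorder.frestrictLe n := rfl
  -- The transition kernel sees the history only through its last coordinate `e`, so the identity
  -- for (history, next state) is tested on preimages under `Prod.map e id`.
  ext s hs
  have hpre : MeasurableSet (Prod.map e id ⁻¹' s : Set (_ × (ZigZagSpace × ℝ))) :=
    (hem.prodMap measurable_id) hs
  have H' := congrArg (fun μ => μ (Prod.map e id ⁻¹' s)) H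
  rw [Measure.compProd_apply hpre, Measure.map_apply
    (hfr.prodMk (measurable_pi_apply _)) hpre] at H'
  have hm : Measurable fun ω : ℕ → ZigZagSpace × ℝ => (ω n, ω (n + 1)) :=
    (measurable_pi_apply _).prodMk (measurable_pi_apply _)
  rw [Measure.map_apply hm hs,
    Measure.compProd_apply hs, hn, ← Measure.map_map hem hfr,
    lintegral_map (Kernel.measurable_kernel_prodMk_left hs) hem]
  exact H'.symm

theorem ae_law_zero (x : ZigZagSpace) : ∀ᵐ ω ∂(M.law x), ω 0 = (x, 0) := by
  have hx : ∀ᵐ h ∂((Measure.dirac (x, (0 : ℝ))).map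
      (MeasurableEquiv.piUnique fun _ : Finset.Iic 0 => ZigZagSpace × ℝ).symm),
      h ⟨0, Finset.mem_Iic.2 le_rfl⟩ = (x, (0 : ℝ)) := by
    rw [Measure.map_dirac' (MeasurableEquiv.measurable _), ae_dirac_iff]
    · rfl
    · exact (measurable_pi_apply _) (measurableSet_singleton _)
  rw [law, Kernel.trajMeasure]
  refine Measure.ae_comp_of_ae_ae ((measurable_pi_apply 0) (measurableSet_singleton _)) ?_
  filter_upwards [hx] with h hh
  -- The trajectory kernel leaves the prescribed initial history unchanged.
  rw [← Kernel.traj_map_updateFinset (X := fun _ : ℕ => ZigZagSpace × ℝ) h]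
  refine (ae_map_iff measurable_updateFinset_left.aemeasurable
    ((measurable_pi_apply 0) (measurableSet_singleton _))).2 (ae_of_all _ fun ω => ?_)
  simpa [Function.updateFinset] using hh

/-- A relation holding almost surely for each step of the jump kernel holds almost surely for
consecutive terms of the chain. -/
theorem ae_law_pair (x : ZigZagSpace) (n : ℕ)
    {r : (ZigZagSpace × ℝ) × (ZigZagSpace × ℝ) → Prop} (hr : MeasurableSet {p | r p})
    (h : ∀ p, ∀ᵐ z ∂M.holdingLaw p.1, r (p, M.jump (p, z))) :
    ∀ᵐ ω ∂(M.law x), r (ω n, ω (n + 1)) := by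
  have hm : Measurable fun ω : ℕ → ZigZagSpace × ℝ => (ω n, ω (n + 1)) :=
    (measurable_pi_apply _).prodMk (measurable_pi_apply _)
  refine (ae_map_iff hm.aemeasurable hr).1 ?_
  rw [map_law_pair]
  refine Measure.ae_compProd_of_ae_ae hr (ae_of_all _ fun p => ?_)
  rw [jumpKernel_apply]
  exact (ae_map_iff (M.measurable_jump.comp measurable_prodMk_left).aemeasurable
    (measurable_prodMk_left hr)).2 (h p)

theorem integral_law_pair (x : ZigZagSpace) (n : ℕ)
    {f : (ZigZagSpace × ℝ) × (ZigZagSpace × ℝ) → ℝ} (hf : Measurable f) {C : ℝ}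
    (hC : ∀ p, |f p| ≤ C) :
    ∫ ω, f (ω n, ω (n + 1)) ∂(M.law x) =
      ∫ ω, ∫ q, f (ω n, q) ∂(M.jumpKernel (ω n)) ∂(M.law x) := by
  have hm : Measurable fun ω : ℕ → ZigZagSpace × ℝ => (ω n, ω (n + 1)) :=
    (measurable_pi_apply _).prodMk (measurable_pi_apply _)
  have hn : Measurable fun ω : ℕ → ZigZagSpace × ℝ => ω n := measurable_pi_apply _
  have : IsProbabilityMeasure ((M.law x).map (fun ω => ω n)) :=
    Measure.isProbabilityMeasure_map hn.aemeasurable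
  have hint : Integrable f ((M.law x).map (fun ω => ω n) ⊗ₘ M.jumpKernel) :=
    .of_bound hf.aestronglyMeasurable C (ae_of_all _ hC)
  have h1 : ∫ ω, f (ω n, ω (n + 1)) ∂(M.law x) =
      ∫ p, f p ∂(M.law x).map (fun ω => (ω n, ω (n + 1))) :=
    (integral_map hm.aemeasurable hf.aestronglyMeasurable).symm
  rw [h1, map_law_pair, Measure.integral_compProd hint, integral_map hn.aemeasurable]
  exact (hf.stronglyMeasurable.integral_kernel_prod_right'
    (κ := M.jumpKernel)).aestronglyMeasurable

/-- The one-step expectation operator of the chain. -/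
noncomputable def jumpMean (f : ZigZagSpace × ℝ → ℝ) (p : ZigZagSpace × ℝ) : ℝ :=
  ∫ q, f q ∂(M.jumpKernel p)

theorem measurable_jumpMean {f : ZigZagSpace × ℝ → ℝ} (hf : Measurable f) :
    Measurable (M.jumpMean f) :=
  (hf.stronglyMeasurable.integral_kernel (κ := M.jumpKernel)).measurable

theorem abs_jumpMean_le {f : ZigZagSpace × ℝ → ℝ} {C : ℝ} (hC : ∀ p, |f p| ≤ C)
    (p : ZigZagSpace × ℝ) : |M.jumpMean f p| ≤ C := by
  simpa [jumpMean] using norm_integral_le_of_norm_le_const (μ := M.jumpKernel p)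
    (ae_of_all _ fun q => (Real.norm_eq_abs (f q)).trans_le (hC q))

theorem integral_law_eq_iterate (x : ZigZagSpace) (n : ℕ) {f : ZigZagSpace × ℝ → ℝ}
    (hf : Measurable f) {C : ℝ} (hC : ∀ p, |f p| ≤ C) :
    ∫ ω, f (ω n) ∂(M.law x) = M.jumpMean^[n] f (x, 0) := by
  induction n generalizing f with
  | zero =>
    rw [integral_congr_ae (g := fun _ => f (x, 0))]
    · simp
    · filter_upwards [M.ae_law_zero x] with ω hω
      rw [hω]
  | succ n ih =>
    rw [Function.iterate_succ_apply, ← ih (M.measurable_jumpMean hf) (M.abs_jumpMean_le hC)]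
    exact M.integral_law_pair x n (hf.comp measurable_snd) fun p => hC p.2

/-! ### The renewal operator: continuity and factorial decay. -/

/-- The density of the holding-time law `holdingLaw x`. -/
noncomputable def holdingDensity (x : ZigZagSpace) (t : ℝ) : ℝ :=
  M.rate (M.flow x t) * M.survival x t

theorem continuous_holdingDensity :
    Continuous fun p : ZigZagSpace × ℝ => M.holdingDensity p.1 p.2 :=
  M.continuous_rate_flow.mul M.continuous_survival

theorem holdingDensity_nonneg (x : ZigZagSpace) (t : ℝ) : 0 ≤ M.holdingDensity x t :=
  mul_nonneg (M.rate_nonneg _) (Real.exp_pos _).le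

theorem survival_le_one (x : ZigZagSpace) {t : ℝ} (ht : 0 ≤ t) : M.survival x t ≤ 1 := by
  rw [survival, Real.exp_le_one_iff, neg_nonpos]
  exact intervalIntegral.integral_nonneg ht fun s _ => M.rate_nonneg _

theorem continuous_jump : Continuous M.jump := by
  have hf : Continuous fun p : (ZigZagSpace × ℝ) × ℝ => M.flow p.1.1 p.2 :=
    M.continuous_flow.comp (by fun_prop : Continuous fun p : (ZigZagSpace × ℝ) × ℝ => (p.1.1, p.2))
  unfold jump
  fun_prop

theorem ae_holdingLaw_pos (x : ZigZagSpace) : ∀ᵐ z ∂M.holdingLaw x, 0 < z :=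
  (withDensity_absolutelyContinuous _ _).ae_le (ae_restrict_mem measurableSet_Ioi)

theorem jumpMean_eq_setIntegral {f : ZigZagSpace × ℝ → ℝ} (hf : Measurable f)
    (p : ZigZagSpace × ℝ) :
    M.jumpMean f p = ∫ z in Ioi 0, M.holdingDensity p.1 z * f (M.jump (p, z)) := by
  have hj : Measurable fun z : ℝ => M.jump (p, z) := M.measurable_jump.comp measurable_prodMk_left
  have hd : Measurable fun z => ENNReal.ofReal (M.holdingDensity p.1 z) :=
    (M.continuous_holdingDensity.measurable.comp measurable_prodMk_left).ennreal_ofReal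
  rw [jumpMean, jumpKernel_apply, integral_map hj.aemeasurable hf.aestronglyMeasurable]
  change ∫ z, f (M.jump (p, z)) ∂(volume.restrict (Ioi 0)).withDensity
    (fun z => ENNReal.ofReal (M.holdingDensity p.1 z)) = _
  rw [integral_withDensity_eq_integral_toReal_smul hd (ae_of_all _ fun _ => ENNReal.ofReal_lt_top)]
  simp [ENNReal.toReal_ofReal (M.holdingDensity_nonneg _ _)]

/-- The function of (state, time) `u` cut off after the time horizon `t`. -/
noncomputable def cutoff (t : ℝ) (u : ZigZagSpace × ℝ → ℝ) : ZigZagSpace × ℝ → ℝ :=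
  {p | p.2 ≤ t}.indicator u

theorem measurable_cutoff (t : ℝ) {u : ZigZagSpace × ℝ → ℝ} (hu : Measurable u) :
    Measurable (cutoff t u) :=
  hu.indicator (measurableSet_le measurable_snd measurable_const)

theorem cutoff_of_le {t : ℝ} {u : ZigZagSpace × ℝ → ℝ} {p : ZigZagSpace × ℝ} (h : p.2 ≤ t) :
    cutoff t u p = u p :=
  indicator_of_mem (s := {p : ZigZagSpace × ℝ | p.2 ≤ t}) h u

theorem cutoff_of_lt {t : ℝ} {u : ZigZagSpace × ℝ → ℝ} {p : ZigZagSpace × ℝ} (h : t < p.2) :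
    cutoff t u p = 0 :=
  indicator_of_notMem (s := {p : ZigZagSpace × ℝ | p.2 ≤ t}) (not_le.2 h) u

/-- The renewal operator: expectation of `u` at the next switch, if it happens before the time
horizon `t`. -/
noncomputable def renewal (t : ℝ) (u : ZigZagSpace × ℝ → ℝ) (p : ZigZagSpace × ℝ) : ℝ :=
  ∫ s in (0 : ℝ)..(t - p.2), M.holdingDensity p.1 s * u (M.jump (p, s))

theorem continuous_density_mul_jump {u : ZigZagSpace × ℝ → ℝ} (hu : Continuous u) :
    Continuous fun p : (ZigZagSpace × ℝ) × ℝ =>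
      M.holdingDensity p.1.1 p.2 * u (M.jump p) :=
  (M.continuous_holdingDensity.comp
    (by fun_prop : Continuous fun p : (ZigZagSpace × ℝ) × ℝ => (p.1.1, p.2))).mul
    (hu.comp M.continuous_jump)

/-- The oriented integral keeps this valid also for `p.2 > t`, where the value has no probabilistic
meaning and is later discarded by `cutoff`. -/
theorem continuous_renewal (t : ℝ) {u : ZigZagSpace × ℝ → ℝ} (hu : Continuous u) :
    Continuous (M.renewal t u) :=
  intervalIntegral.continuous_parametric_intervalIntegral_of_continuous
    (f := fun p s => M.holdingDensity p.1 s * u (M.jump (p, s)))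
    (M.continuous_density_mul_jump hu) (continuous_const.sub continuous_snd)

theorem continuous_iterate_renewal (t : ℝ) {u : ZigZagSpace × ℝ → ℝ} (hu : Continuous u) (n : ℕ) :
    Continuous ((M.renewal t)^[n] u) := by
  induction n with
  | zero => exact hu
  | succ n ih =>
    rw [Function.iterate_succ_apply']
    exact M.continuous_renewal t ih

/-- The discontinuous indicator of the horizon becomes a limit of integration. Since holding times
are positive, a chain already past `t` stays past it, so the cutoff survives iteration. -/
theorem jumpMean_cutoff (t : ℝ) {u : ZigZagSpace × ℝ → ℝ} (hu : Continuous u) :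
    M.jumpMean (cutoff t u) = cutoff t (M.renewal t u) := by
  funext p
  rw [M.jumpMean_eq_setIntegral (measurable_cutoff t hu.measurable)]
  have h : ∀ z, M.holdingDensity p.1 z * cutoff t u (M.jump (p, z)) =
      (Iic (t - p.2)).indicator (fun z => M.holdingDensity p.1 z * u (M.jump (p, z))) z := by
    intro z
    by_cases hz : z ≤ t - p.2
    · rw [indicator_of_mem (mem_Iic.2 hz), cutoff_of_le]
      change p.2 + z ≤ t
      linarith
    · rw [indicator_of_notMem (notMem_Iic.2 (not_le.1 hz)), cutoff_of_lt, mul_zero]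
      change t < p.2 + z
      linarith [not_le.1 hz]
  simp_rw [h]
  rw [setIntegral_indicator measurableSet_Iic, Ioi_inter_Iic]
  rcases le_or_gt p.2 t with hp | hp
  · rw [cutoff_of_le hp, renewal, intervalIntegral.integral_of_le (by linarith)]
  · rw [cutoff_of_lt hp, Ioc_eq_empty (by linarith), setIntegral_empty]

theorem iterate_jumpMean_cutoff (t : ℝ) {u : ZigZagSpace × ℝ → ℝ} (hu : Continuous u) (n : ℕ) :
    M.jumpMean^[n] (cutoff t u) = cutoff t ((M.renewal t)^[n] u) := by
  induction n with
  | zero => rfl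
  | succ n ih =>
    rw [Function.iterate_succ_apply', ih,
      M.jumpMean_cutoff t (M.continuous_iterate_renewal t hu n), Function.iterate_succ_apply']

theorem abs_cast_direction (j : ℤˣ) : |((j : ℤ) : ℝ)| = 1 := by
  rcases Int.units_eq_one_or j with rfl | rfl <;> simp

theorem abs_flow_sub (x : ZigZagSpace) (s : ℝ) : |(M.flow x s).1 - x.1| = M.a * |s| := by
  simp [flow, abs_mul, abs_cast_direction, abs_of_pos M.a_pos]

theorem exists_rate_le (R : ℝ) : ∃ Λ : ℝ, 0 ≤ Λ ∧ ∀ x : ZigZagSpace, |x.1| ≤ R → M.rate x ≤ Λ := by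
  obtain ⟨C, hC⟩ := ((isCompact_Icc (a := -R) (b := R)).prod
    (isCompact_univ (X := ℤˣ))).exists_bound_of_continuousOn M.rate_continuous.continuousOn
  refine ⟨max C 0, le_max_right _ _, fun x hx => le_max_of_le_left ?_⟩
  exact (le_abs_self _).trans (hC x ⟨abs_le.1 hx, mem_univ _⟩)

/-- Poisson-type bound for the probability of `n` switches before the time horizon. -/
theorem abs_iterate_renewal_le {t R Λ C : ℝ} (hΛ : 0 ≤ Λ)
    (hrate : ∀ x : ZigZagSpace, |x.1| ≤ R + M.a * t → M.rate x ≤ Λ)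
    {u : ZigZagSpace × ℝ → ℝ} (hC : ∀ p, p.2 ≤ t → |u p| ≤ C)
    (n : ℕ) {p : ZigZagSpace × ℝ} (hp : p.2 ≤ t) (hpR : |p.1.1| ≤ R + M.a * p.2) :
    |(M.renewal t)^[n] u p| ≤ C * (Λ * (t - p.2)) ^ n / n.factorial := by
  induction n generalizing p with
  | zero => simpa using hC p hp
  | succ n ih =>
    have h0 : 0 ≤ t - p.2 := by linarith
    have ha := M.a_pos
    rw [Function.iterate_succ_apply', renewal]
    have hbound : ∀ s ∈ Ioc 0 (t - p.2),
        ‖M.holdingDensity p.1 s * (M.renewal t)^[n] u (M.jump (p, s))‖ ≤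
          Λ * (C * (Λ * (t - p.2 - s)) ^ n / n.factorial) := by
      rintro s ⟨hs0, hs⟩
      -- The invariant $|y|\le R+a\cdot\text{time}$ passes to the next switch because the speed is
      -- $a$; before the horizon it keeps the path where `Λ` bounds the rate.
      have hflow : |(M.flow p.1 s).1| ≤ R + M.a * (p.2 + s) := by
        have h1 := M.abs_flow_sub p.1 s
        rw [abs_of_pos hs0] at h1
        have h2 := abs_sub_abs_le_abs_sub (M.flow p.1 s).1 p.1.1
        linarith
      have hts : p.2 + s ≤ t := by linarith
      rw [norm_mul, Real.norm_eq_abs, Real.norm_eq_abs, abs_of_nonneg (M.holdingDensity_nonneg _ _)]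
      have hih := ih (p := M.jump (p, s)) hts hflow
      have e : t - (M.jump (p, s)).2 = t - p.2 - s := by
        change t - (p.2 + s) = _
        ring
      rw [e] at hih
      refine mul_le_mul ?_ hih (abs_nonneg _) hΛ
      have hr : M.rate (M.flow p.1 s) ≤ Λ := by
        refine hrate _ (hflow.trans ?_)
        gcongr
      calc M.holdingDensity p.1 s ≤ Λ * 1 :=
            mul_le_mul hr (M.survival_le_one _ hs0.le) (Real.exp_pos _).le hΛ
        _ = Λ := mul_one _
    have hi := intervalIntegral.norm_integral_le_of_norm_le (μ := volume) h0
      (ae_of_all _ hbound) (Continuous.intervalIntegrable (by fun_prop) _ _)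
    refine (Real.norm_eq_abs _).symm.trans_le (hi.trans_eq ?_)
    have e : ∀ s : ℝ, Λ * (C * (Λ * (t - p.2 - s)) ^ n / n.factorial) =
        C * Λ ^ (n + 1) / n.factorial * (t - p.2 - s) ^ n := by
      intro s
      rw [mul_pow]
      ring
    simp_rw [e]
    rw [intervalIntegral.integral_const_mul,
      intervalIntegral.integral_comp_sub_left (fun s => s ^ n) (t - p.2), integral_pow,
      Nat.factorial_succ]
    push_cast
    have : (n.factorial : ℝ) ≠ 0 := by positivity
    have : (n : ℝ) + 1 ≠ 0 := by positivity
    simp only [sub_self, sub_zero, mul_pow, zero_pow (Nat.succ_ne_zero n)]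
    field_simp

/-! ### Non-explosion. -/

theorem measurable_switchTime (n : ℕ) : Measurable fun ω => switchTime ω n :=
  measurable_snd.comp (measurable_pi_apply n)

theorem measurableSet_switchTime_le (t : ℝ) (n : ℕ) : MeasurableSet {ω | switchTime ω n ≤ t} :=
  measurableSet_le (measurable_switchTime n) measurable_const

theorem measureReal_switchTime_le {t R Λ : ℝ} (ht : 0 ≤ t) (hΛ : 0 ≤ Λ)
    (hrate : ∀ x : ZigZagSpace, |x.1| ≤ R + M.a * t → M.rate x ≤ Λ)
    {x : ZigZagSpace} (hx : |x.1| ≤ R) (n : ℕ) :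
    (M.law x).real {ω | switchTime ω n ≤ t} ≤ (Λ * t) ^ n / n.factorial := by
  have hc : Continuous fun _ : ZigZagSpace × ℝ => (1 : ℝ) := continuous_const
  have hb : ∀ p, |cutoff t (fun _ => (1 : ℝ)) p| ≤ 1 := by
    intro p
    rcases le_or_gt p.2 t with h | h
    · simp [cutoff_of_le h]
    · simp [cutoff_of_lt h]
  have h1 : (M.law x).real {ω | switchTime ω n ≤ t} =
      ∫ ω, cutoff t (fun _ => (1 : ℝ)) (ω n) ∂(M.law x) := by
    rw [← integral_indicator_one (measurableSet_switchTime_le t n)]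
    rfl
  rw [h1, M.integral_law_eq_iterate x n (measurable_cutoff t hc.measurable) hb,
    M.iterate_jumpMean_cutoff t hc n, cutoff_of_le ht]
  have h2 := M.abs_iterate_renewal_le (R := R) (C := 1) (u := fun _ => 1) hΛ hrate
    (by simp) n (p := (x, 0)) ht (by simpa using hx)
  simpa using (le_abs_self _).trans h2

/-- Used twice: for Borel–Cantelli, and as the dominating series when the expectation is summed term
by term. -/
theorem summable_measureReal_switchTime_le (x : ZigZagSpace) {t : ℝ} (ht : 0 ≤ t) :
    Summable fun n => (M.law x).real {ω | switchTime ω n ≤ t} := by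
  obtain ⟨Λ, hΛ, hrate⟩ := M.exists_rate_le (|x.1| + M.a * t)
  exact .of_nonneg_of_le (fun _ => measureReal_nonneg)
    (M.measureReal_switchTime_le ht hΛ hrate le_rfl) (Real.summable_pow_div_factorial _)

/-- Non-explosion: the switching times tend to infinity almost surely. -/
theorem ae_tendsto_switchTime (x : ZigZagSpace) :
    ∀ᵐ ω ∂(M.law x), Tendsto (fun n => switchTime ω n) atTop atTop := by
  have h : ∀ k : ℕ, ∀ᵐ ω ∂(M.law x), ∀ᶠ n in atTop, ω ∉ {ω | switchTime ω n ≤ (k : ℝ)} := by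
    intro k
    refine ae_eventually_notMem ?_
    have := (M.summable_measureReal_switchTime_le x k.cast_nonneg).tsum_ofReal_ne_top
    simpa [ofReal_measureReal] using this
  filter_upwards [ae_all_iff.2 h] with ω hω
  refine tendsto_atTop.2 fun b => ?_
  obtain ⟨k, hk⟩ := exists_nat_ge b
  filter_upwards [hω k] with n hn
  exact hk.trans (not_le.1 hn).le

/-! ### Regularity of paths and finite speed. -/

/-- The path regularity of the skeleton chain: it starts at `(x, 0)`, its switching times increase
strictly and it moves with speed at most `a`. -/
theorem ae_law_path (x : ZigZagSpace) :
    ∀ᵐ ω ∂(M.law x), ω 0 = (x, 0) ∧ StrictMono (switchTime ω) ∧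
      ∀ n, |(ω n).1.1 - x.1| ≤ M.a * switchTime ω n := by
  have h : ∀ n : ℕ, ∀ᵐ ω ∂(M.law x), switchTime ω n < switchTime ω (n + 1) ∧
      |(ω (n + 1)).1.1 - (ω n).1.1| ≤ M.a * (switchTime ω (n + 1) - switchTime ω n) := by
    intro n
    refine M.ae_law_pair x n (r := fun p => p.1.2 < p.2.2 ∧
      |p.2.1.1 - p.1.1.1| ≤ M.a * (p.2.2 - p.1.2)) ?_ fun p => ?_
    · have h1 : MeasurableSet {p : (ZigZagSpace × ℝ) × (ZigZagSpace × ℝ) | p.1.2 < p.2.2} :=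
        measurableSet_lt (by fun_prop) (by fun_prop)
      have h2 : MeasurableSet {p : (ZigZagSpace × ℝ) × (ZigZagSpace × ℝ) |
          |p.2.1.1 - p.1.1.1| ≤ M.a * (p.2.2 - p.1.2)} :=
        measurableSet_le (Measurable.abs (by fun_prop)) (by fun_prop)
      exact h1.inter h2
    · filter_upwards [M.ae_holdingLaw_pos p.1] with z hz
      refine ⟨lt_add_of_pos_right _ hz, ?_⟩
      have := M.abs_flow_sub p.1 z
      rw [abs_of_pos hz] at this
      simpa [jump] using this.le
  filter_upwards [M.ae_law_zero x, ae_all_iff.2 h] with ω h0 hω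
  refine ⟨h0, strictMono_nat_of_lt_succ fun n => (hω n).1, fun n => ?_⟩
  induction n with
  | zero => simp [h0, switchTime]
  | succ n ih =>
    have := abs_sub_le (ω (n + 1)).1.1 (ω n).1.1 x.1
    linarith [(hω n).2]

theorem switchCount_eq {ω : ℕ → ZigZagSpace × ℝ} {t : ℝ} (hω : StrictMono (switchTime ω)) {n : ℕ}
    (h : switchTime ω n ≤ t) (h' : t < switchTime ω (n + 1)) : switchCount t ω = n := by
  have : {k : ℕ | switchTime ω k ≤ t} = Iic n := by
    ext k
    refine ⟨fun hk => ?_, fun hk => (hω.monotone hk).trans h⟩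
    exact Nat.lt_succ_iff.1 (hω.lt_iff_lt.1 (hk.trans_lt h'))
  rw [switchCount, this, csSup_Iic]

/-- On such paths $t$ lies in exactly one interval $[T_n,T_{n+1})$, so the default value of `sSup`
never intervenes. -/
theorem switchTime_switchCount {ω : ℕ → ZigZagSpace × ℝ} {t : ℝ} (ht : 0 ≤ t)
    (h0 : switchTime ω 0 = 0) (hω : StrictMono (switchTime ω))
    (hlim : Tendsto (switchTime ω) atTop atTop) :
    switchTime ω (switchCount t ω) ≤ t ∧ t < switchTime ω (switchCount t ω + 1) := by
  have hex : ∃ n, t < switchTime ω n := (hlim.eventually_gt_atTop t).exists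
  classical
  obtain ⟨n, hn⟩ : ∃ n, Nat.find hex = n + 1 :=
    Nat.exists_eq_succ_of_ne_zero fun h => by
      have := Nat.find_spec hex
      rw [h, h0] at this
      linarith
  have h1 : switchTime ω n ≤ t := not_lt.1 (Nat.find_min hex (by omega))
  have h2 : t < switchTime ω (n + 1) := hn ▸ Nat.find_spec hex
  rw [switchCount_eq hω h1 h2]
  exact ⟨h1, h2⟩

theorem ae_abs_process_sub_le (x : ZigZagSpace) {t : ℝ} (ht : 0 ≤ t) :
    ∀ᵐ ω ∂(M.law x), |(M.process t ω).1 - x.1| ≤ M.a * t := by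
  filter_upwards [M.ae_law_path x, M.ae_tendsto_switchTime x] with ω ⟨h0, hω, hd⟩ hlim
  have h := (switchTime_switchCount ht (by rw [switchTime, h0]) hω hlim).1
  have h1 := M.abs_flow_sub (ω (switchCount t ω)).1 (t - switchTime ω (switchCount t ω))
  rw [abs_of_nonneg (sub_nonneg.2 h)] at h1
  have h2 := abs_sub_le (M.process t ω).1 (ω (switchCount t ω)).1.1 x.1
  have h3 := hd (switchCount t ω)
  change |(M.process t ω).1 - (ω (switchCount t ω)).1.1| = _ at h1
  linarith

/-! ### Expansion of the semigroup by the number of switches. -/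

/-- The contribution to `φ (process t)` of the event that a skeleton step from `p.1` to `p.2` is
the one under way at time `t`. -/
noncomputable def stepValue (t : ℝ) (φ : ZigZagSpace → ℝ)
    (p : (ZigZagSpace × ℝ) × (ZigZagSpace × ℝ)) : ℝ :=
  {p : (ZigZagSpace × ℝ) × (ZigZagSpace × ℝ) | p.1.2 ≤ t ∧ t < p.2.2}.indicator
    (fun p => φ (M.flow p.1.1 (t - p.1.2))) p

theorem continuous_flow_until (t : ℝ) :
    Continuous fun p : ZigZagSpace × ℝ => M.flow p.1 (t - p.2) :=
  M.continuous_flow.comp (by fun_prop : Continuous fun p : ZigZagSpace × ℝ => (p.1, t - p.2))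

theorem measurable_stepValue (t : ℝ) {φ : ZigZagSpace → ℝ} (hφ : Continuous φ) :
    Measurable (M.stepValue t φ) := by
  have h1 : MeasurableSet {p : (ZigZagSpace × ℝ) × (ZigZagSpace × ℝ) | p.1.2 ≤ t} :=
    measurableSet_le (by fun_prop) (by fun_prop)
  have h2 : MeasurableSet {p : (ZigZagSpace × ℝ) × (ZigZagSpace × ℝ) | t < p.2.2} :=
    measurableSet_lt (by fun_prop) (by fun_prop)
  exact ((hφ.comp (M.continuous_flow_until t)).measurable.comp measurable_fst).indicator
    (h1.inter h2)

/-- Dropping the condition $t<T_{n+1}$ leaves the event $T_n\le t$, whose probabilities are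
summable. -/
theorem abs_stepValue_le (t : ℝ) {φ : ZigZagSpace → ℝ} {C : ℝ} (hC : ∀ x, |φ x| ≤ C)
    (p : (ZigZagSpace × ℝ) × (ZigZagSpace × ℝ)) :
    |M.stepValue t φ p| ≤ {p : (ZigZagSpace × ℝ) × (ZigZagSpace × ℝ) | p.1.2 ≤ t}.indicator
      (fun _ => C) p := by
  by_cases h : p.1.2 ≤ t ∧ t < p.2.2
  · have h1 : p ∈ {p : (ZigZagSpace × ℝ) × (ZigZagSpace × ℝ) | p.1.2 ≤ t} := h.1
    rw [stepValue, indicator_of_mem (s := {p : (ZigZagSpace × ℝ) × (ZigZagSpace × ℝ) |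
      p.1.2 ≤ t ∧ t < p.2.2}) h, indicator_of_mem h1]
    exact hC _
  · rw [stepValue, indicator_of_notMem (s := {p : (ZigZagSpace × ℝ) × (ZigZagSpace × ℝ) |
      p.1.2 ≤ t ∧ t < p.2.2}) h, abs_zero]
    exact indicator_nonneg (fun _ _ => (abs_nonneg _).trans (hC p.1.1)) _

theorem hasSum_stepValue {t : ℝ} (ht : 0 ≤ t) (φ : ZigZagSpace → ℝ) {ω : ℕ → ZigZagSpace × ℝ}
    (h0 : switchTime ω 0 = 0) (hω : StrictMono (switchTime ω))
    (hlim : Tendsto (switchTime ω) atTop atTop) :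
    HasSum (fun n => M.stepValue t φ (ω n, ω (n + 1))) (φ (M.process t ω)) := by
  have h := switchTime_switchCount ht h0 hω hlim
  have e : φ (M.process t ω) =
      M.stepValue t φ (ω (switchCount t ω), ω (switchCount t ω + 1)) := by
    rw [stepValue, indicator_of_mem (s := {p : (ZigZagSpace × ℝ) × (ZigZagSpace × ℝ) |
      p.1.2 ≤ t ∧ t < p.2.2}) h]
    rfl
  rw [e]
  refine hasSum_single _ fun n hn => ?_
  exact indicator_of_notMem (s := {p : (ZigZagSpace × ℝ) × (ZigZagSpace × ℝ) |
      p.1.2 ≤ t ∧ t < p.2.2}) (fun hm => hn (switchCount_eq hω hm.1 hm.2).symm) _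

/-- The expectation of `φ` at time `t` on the event that no switch occurs after the state and time
`p`. -/
noncomputable def noSwitchValue (t : ℝ) (φ : ZigZagSpace → ℝ) (p : ZigZagSpace × ℝ) : ℝ :=
  φ (M.flow p.1 (t - p.2)) * M.survival p.1 (t - p.2)

theorem continuous_noSwitchValue (t : ℝ) {φ : ZigZagSpace → ℝ} (hφ : Continuous φ) :
    Continuous (M.noSwitchValue t φ) :=
  (hφ.comp (M.continuous_flow_until t)).mul
    (M.continuous_survival.comp (by fun_prop : Continuous fun p : ZigZagSpace × ℝ => (p.1, t - p.2)))

theorem abs_noSwitchValue_le {t : ℝ} {φ : ZigZagSpace → ℝ} {C : ℝ} (hC : ∀ x, |φ x| ≤ C)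
    {p : ZigZagSpace × ℝ} (hp : p.2 ≤ t) : |M.noSwitchValue t φ p| ≤ C := by
  have hs : 0 ≤ M.survival p.1 (t - p.2) := (Real.exp_pos _).le
  rw [noSwitchValue, abs_mul, abs_of_nonneg hs]
  calc _ ≤ C * 1 := mul_le_mul (hC _) (M.survival_le_one _ (sub_nonneg.2 hp)) hs
        ((abs_nonneg _).trans (hC p.1))
    _ = C := mul_one C

/-- Given `p`, the position at time `t` is deterministic as long as no switch occurs, and `survival`
is the probability of that. -/
theorem integral_stepValue (t : ℝ) (φ : ZigZagSpace → ℝ) (p : ZigZagSpace × ℝ) :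
    ∫ q, M.stepValue t φ (p, q) ∂(M.jumpKernel p) = cutoff t (M.noSwitchValue t φ) p := by
  rcases le_or_gt p.2 t with hp | hp
  · have hm : MeasurableSet {q : ZigZagSpace × ℝ | t < q.2} :=
      measurableSet_lt measurable_const measurable_snd
    have e : ∀ q, M.stepValue t φ (p, q) =
        {q : ZigZagSpace × ℝ | t < q.2}.indicator (fun _ => φ (M.flow p.1 (t - p.2))) q := by
      intro q
      simp [stepValue, indicator, hp]
    have hpre : (fun z => M.jump (p, z)) ⁻¹' {q : ZigZagSpace × ℝ | t < q.2} = Ioi (t - p.2) := by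
      ext z
      exact (sub_lt_iff_lt_add' (a := t) (b := p.2) (c := z)).symm
    have hj : Measurable fun z : ℝ => M.jump (p, z) :=
      M.measurable_jump.comp measurable_prodMk_left
    simp_rw [e]
    rw [integral_indicator_const _ hm, measureReal_def, jumpKernel_apply,
      Measure.map_apply hj hm, hpre,
      M.holdingLaw_Ioi _ (sub_nonneg.2 hp), cutoff_of_le hp, noSwitchValue,
      ENNReal.toReal_ofReal (r := M.survival _ _) (Real.exp_pos _).le, smul_eq_mul, mul_comm]
  · have e : ∀ q, M.stepValue t φ (p, q) = 0 := by
      intro q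
      simp [stepValue, indicator, hp.not_ge]
    simp [e, cutoff_of_lt hp]

theorem integral_law_stepValue (x : ZigZagSpace) {t : ℝ} (ht : 0 ≤ t) {φ : ZigZagSpace → ℝ}
    (hφ : Continuous φ) {C : ℝ} (hC : ∀ x, |φ x| ≤ C) (n : ℕ) :
    ∫ ω, M.stepValue t φ (ω n, ω (n + 1)) ∂(M.law x) =
      (M.renewal t)^[n] (M.noSwitchValue t φ) (x, 0) := by
  have hC0 : 0 ≤ C := (abs_nonneg _).trans (hC x)
  rw [M.integral_law_pair x n (M.measurable_stepValue t hφ) (C := C) fun p =>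
    (M.abs_stepValue_le t hC p).trans (indicator_le_self' (fun _ _ => hC0) p)]
  simp_rw [integral_stepValue]
  have hc := M.continuous_noSwitchValue t hφ
  rw [M.integral_law_eq_iterate x n (measurable_cutoff t hc.measurable) (C := C),
    M.iterate_jumpMean_cutoff t hc n, cutoff_of_le ht]
  intro p
  rcases le_or_gt p.2 t with hp | hp
  · rw [cutoff_of_le hp]
    exact M.abs_noSwitchValue_le hC hp
  · rw [cutoff_of_lt hp, abs_zero]
    exact hC0

theorem integrable_stepValue (x : ZigZagSpace) (t : ℝ) {φ : ZigZagSpace → ℝ}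
    (hφ : Continuous φ) {C : ℝ} (hC : ∀ x, |φ x| ≤ C) (n : ℕ) :
    Integrable (fun ω => M.stepValue t φ (ω n, ω (n + 1))) (M.law x) := by
  have hC0 : 0 ≤ C := (abs_nonneg _).trans (hC x)
  have hm : Measurable fun ω : ℕ → ZigZagSpace × ℝ => (ω n, ω (n + 1)) :=
    (measurable_pi_apply _).prodMk (measurable_pi_apply _)
  exact .of_bound ((M.measurable_stepValue t hφ).comp hm).aestronglyMeasurable C
    (ae_of_all _ fun ω => (M.abs_stepValue_le t hC _).trans (indicator_le_self' (fun _ _ => hC0) _))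

theorem ae_hasSum_stepValue (x : ZigZagSpace) {t : ℝ} (ht : 0 ≤ t) (φ : ZigZagSpace → ℝ) :
    ∀ᵐ ω ∂(M.law x),
      HasSum (fun n => M.stepValue t φ (ω n, ω (n + 1))) (φ (M.process t ω)) := by
  filter_upwards [M.ae_law_path x, M.ae_tendsto_switchTime x] with ω ⟨h0, hω, _⟩ hlim
  exact M.hasSum_stepValue ht φ (by rw [switchTime, h0]) hω hlim

theorem integrable_process (x : ZigZagSpace) {t : ℝ} (ht : 0 ≤ t) {φ : ZigZagSpace → ℝ}
    (hφ : Continuous φ) {C : ℝ} (hC : ∀ x, |φ x| ≤ C) :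
    Integrable (fun ω => φ (M.process t ω)) (M.law x) := by
  -- Measurability comes from the almost sure limit of the partial sums, without examining
  -- `switchCount`.
  refine .of_bound (aestronglyMeasurable_of_tendsto_ae atTop (f := fun n ω =>
    ∑ i ∈ Finset.range n, M.stepValue t φ (ω i, ω (i + 1))) (fun n => ?_) ?_) C
    (ae_of_all _ fun ω => hC _)
  · exact (integrable_finsetSum _ fun i _ => M.integrable_stepValue x t hφ hC i).1
  · filter_upwards [M.ae_hasSum_stepValue x ht φ] with ω hω
    exact hω.tendsto_sum_nat

theorem hasSum_semigroup (x : ZigZagSpace) {t : ℝ} (ht : 0 ≤ t) {φ : ZigZagSpace → ℝ}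
    (hφ : Continuous φ) {C : ℝ} (hC : ∀ x, |φ x| ≤ C) :
    HasSum (fun n => (M.renewal t)^[n] (M.noSwitchValue t φ) (x, 0)) (M.semigroup t φ x) := by
  have hsum : Summable fun n => ∫ ω, ‖M.stepValue t φ (ω n, ω (n + 1))‖ ∂(M.law x) := by
    refine .of_nonneg_of_le (fun n => integral_nonneg fun _ => norm_nonneg _) (fun n => ?_)
      ((M.summable_measureReal_switchTime_le x ht).mul_right C)
    have h := integral_indicator_const (μ := M.law x) C (measurableSet_switchTime_le t n)
    rw [smul_eq_mul] at h
    rw [← h]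
    refine integral_mono (M.integrable_stepValue x t hφ hC n).norm
      ((integrable_const C).indicator (measurableSet_switchTime_le t n)) fun ω => ?_
    exact M.abs_stepValue_le t hC _
  have h := hasSum_integral_of_summable_integral_norm
    (fun n => M.integrable_stepValue x t hφ hC n) hsum
  simp_rw [M.integral_law_stepValue x ht hφ hC] at h
  have e : M.semigroup t φ x = ∫ ω, ∑' n, M.stepValue t φ (ω n, ω (n + 1)) ∂(M.law x) :=
    integral_congr_ae ((M.ae_hasSum_stepValue x ht φ).mono fun ω hω => hω.tsum_eq.symm)
  rw [e]
  exact h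

/-! ### The Feller property. -/

theorem continuous_semigroup {t : ℝ} (ht : 0 ≤ t) {φ : ZigZagSpace → ℝ}
    (hφ : Continuous φ) {C : ℝ} (hC : ∀ x, |φ x| ≤ C) : Continuous (M.semigroup t φ) := by
  rw [continuous_iff_continuousAt]
  intro x₀
  -- The extra 1 leaves room for a neighbourhood of `x₀` on which a single `Λ` works.
  set R : ℝ := |x₀.1| + 1
  obtain ⟨Λ, hΛ, hrate⟩ := M.exists_rate_le (R + M.a * t)
  have hopen : IsOpen {x : ZigZagSpace | |x.1| < R} :=
    isOpen_lt (by fun_prop) continuous_const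
  have hfun : M.semigroup t φ =
      fun x => ∑' n, (M.renewal t)^[n] (M.noSwitchValue t φ) (x, 0) :=
    funext fun x => (M.hasSum_semigroup x ht hφ hC).tsum_eq.symm
  have hon : ContinuousOn (M.semigroup t φ) {x : ZigZagSpace | |x.1| < R} := by
    rw [hfun]
    refine continuousOn_tsum (u := fun n : ℕ => C * ((Λ * t) ^ n / n.factorial)) (fun n => ?_)
      ((Real.summable_pow_div_factorial _).mul_left C) fun n x hx => ?_
    · exact ((M.continuous_iterate_renewal t (M.continuous_noSwitchValue t hφ) n).comp
        (by fun_prop)).continuousOn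
    · have hxR : |x.1| ≤ R := le_of_lt hx
      have := M.abs_iterate_renewal_le (R := R) hΛ hrate
        (fun p hp => M.abs_noSwitchValue_le hC hp) n (p := (x, 0)) ht (by simpa using hxR)
      simpa [mul_div_assoc] using this
  exact hon.continuousAt (hopen.mem_nhds (lt_add_one |x₀.1|))

theorem tendsto_semigroup_cocompact (φ : C₀(ZigZagSpace, ℝ)) {t : ℝ} (ht : 0 ≤ t) :
    Tendsto (M.semigroup t φ) (cocompact ZigZagSpace) (𝓝 0) := by
  rw [Metric.tendsto_nhds]
  intro ε hε
  have hφ := (Metric.tendsto_nhds.1 φ.zero_at_infty') (ε / 2) (half_pos hε)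
  obtain ⟨K, hK, hKφ⟩ := mem_cocompact.1 hφ
  obtain ⟨r, hr⟩ := hK.exists_bound_of_continuousOn
    (f := fun x : ZigZagSpace => x.1) continuous_fst.continuousOn
  -- All positions in `K` have modulus at most `r`; a start beyond `r + a t` almost surely cannot be
  -- in `K` at time `t`, so $|\varphi|<\varepsilon/2$ there.
  refine mem_cocompact.2 ⟨Icc (-(r + M.a * t)) (r + M.a * t) ×ˢ univ,
    isCompact_Icc.prod isCompact_univ, fun x hx => ?_⟩
  have hxr : r + M.a * t < |x.1| := by
    by_contra h
    exact hx ⟨abs_le.1 (not_lt.1 h), mem_univ _⟩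
  have hb : ‖M.semigroup t φ x‖ ≤ ε / 2 := by
    have := norm_integral_le_of_norm_le_const (μ := M.law x) (C := ε / 2)
      (f := fun ω => φ (M.process t ω)) ?_
    · simpa [semigroup] using this
    filter_upwards [M.ae_abs_process_sub_le x ht] with ω hω
    have hout : M.process t ω ∈ Kᶜ := fun hmem => by
      have h1 := hr _ hmem
      rw [Real.norm_eq_abs] at h1
      have h2 := abs_sub_abs_le_abs_sub x.1 (M.process t ω).1
      rw [abs_sub_comm] at h2
      linarith
    have := hKφ hout
    rw [mem_ofPred_eq, dist_zero_right] at this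
    exact this.le
  rw [mem_ofPred_eq, dist_zero_right]
  linarith

end ZigZagModel

theorem mainTheorem7 (M : ZigZagModel) :
    (∀ x : ZigZagSpace, ∀ᵐ ω ∂(M.law x),
      Tendsto (fun n => ZigZagModel.switchTime ω n) atTop atTop) ∧
    ∀ (φ : C₀(ZigZagSpace, ℝ)) (t : ℝ), 0 ≤ t →
      (∀ x : ZigZagSpace, Integrable (fun ω => φ (M.process t ω)) (M.law x)) ∧
      ∃ ψ : C₀(ZigZagSpace, ℝ), ∀ x : ZigZagSpace, ψ x = M.semigroup t φ x := by
  refine ⟨M.ae_tendsto_switchTime, fun φ t ht => ?_⟩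
  have hC : ∀ x, |φ x| ≤ ‖φ.toBCF‖ := fun x => φ.toBCF.norm_coe_le_norm x
  have hφ : Continuous φ := φ.continuous
  exact ⟨fun x => M.integrable_process x ht hφ hC,
    ⟨⟨M.semigroup t φ, M.continuous_semigroup ht hφ hC⟩, M.tendsto_semigroup_cocompact φ ht⟩,
    fun x => rfl⟩
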